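/- Let $E$ be a real Banach space with dual $E^*$. For $x\in E$ let $\hat x\in\mathbb R^{E^*}$ be the evaluation $\hat x(x^*)=x^*(x)$, and let $L$ be the vector sublattice of $\mathbb R^{E^*}$ (with pointwise operations) generated by $\{\hat x : x\in E\}$, that is, the smallest linear subspace of $\mathbb R^{E^*}$ that contains all $\hat x$ and is closed under $\vee$ and $\wedge$. A lattice seminorm on $L$ is a seminorm $\nu$ such that $|f|\le|g|$ implies $\nu(f)\le\nu(g)$; lattice homomorphisms are linear maps preserving $\vee$ and $\wedge$. Then, among all lattice seminorms $\nu$ on $L$ satisfying $\nu(\hat x)\le\|x\|$ for all $x\in E$, there is a (pointwise) largest one. This largest $\nu$ is a norm, and $\nu(\hat x)=\|x\|$ for all $x\in E$. The normed lattice $(L,\nu)$ has a completion, i.e. a Banach lattice $X$ with an isometric lattice homomorphism $\iota\colon L\to X$ of dense range; and every such completion is the free Banach lattice $\mathrm{FBL}[E]$: the map $x\mapsto\iota(\hat x)$ is a linear isometry of $E$ onto a closed subspace of $X$, and for every Banach lattice $Y$ and every bounded linear operator $T\colon E\to Y$ there is exactly one lattice homomorphism $\widetilde T\colon X\to Y$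 with $\widetilde T(\iota(\hat x))=Tx$ for all $x\in E$; this $\widetilde T$ is bounded and $\|\widetilde T\|=\|T\|$. -/

import Mathlib

universe u v w

namespace FreeBanachLattice

/-- A (real) Banach lattice: a real Banach space carrying a vector lattice order whose norm is
a lattice norm, i.e. `|x| ≤ |y|` implies `‖x‖ ≤ ‖y‖`. -/
class IsBanachLattice (X : Type*) [NormedAddCommGroup X] [NormedSpace ℝ X] [Lattice X] : Prop
    extends IsOrderedAddMonoid X, IsOrderedModule ℝ X, HasSolidNorm X, CompleteSpace X

/-- A linear map between vector lattices is a lattice homomorphism if it preserves `⊔` and `⊓`. -/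
def IsLatticeHom {X Y : Type*} [AddCommGroup X] [Module ℝ X] [Lattice X]
    [AddCommGroup Y] [Module ℝ Y] [Lattice Y] (T : X →ₗ[ℝ] Y) : Prop :=
  ∀ x y : X, T (x ⊔ y) = T x ⊔ T y ∧ T (x ⊓ y) = T x ⊓ T y

/-- A seminorm on a vector lattice is a lattice seminorm if `|x| ≤ |y|` implies `p x ≤ p y`. -/
def IsLatticeSeminorm {V : Type*} [AddCommGroup V] [Module ℝ V] [Lattice V]
    (p : Seminorm ℝ V) : Prop :=
  ∀ x y : V, |x| ≤ |y| → p x ≤ p y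

/-- A linear subspace that is closed under the lattice operations. -/
def IsVectorSublattice {V : Type*} [AddCommGroup V] [Module ℝ V] [Lattice V]
    (M : Submodule ℝ V) : Prop :=
  ∀ f ∈ M, ∀ g ∈ M, f ⊔ g ∈ M ∧ f ⊓ g ∈ M

/-- The sublattice (in the sense of vector lattices) generated by a set `S`: the smallest linear
subspace that contains `S` and is closed under the lattice operations. -/
def generatedSublattice {V : Type*} [AddCommGroup V] [Module ℝ V] [Lattice V]
    (S : Set V) : Submodule ℝ V :=
  sInf {M : Submodule ℝ V | S ⊆ M ∧ IsVectorSublattice M}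

theorem isVectorSublattice_generatedSublattice {V : Type*} [AddCommGroup V] [Module ℝ V]
    [Lattice V] (S : Set V) : IsVectorSublattice (generatedSublattice S) := by
  intro f hf g hg
  simp only [generatedSublattice, Submodule.mem_sInf] at *
  exact ⟨fun M hM => (hM.2 f (hf M hM) g (hg M hM)).1,
    fun M hM => (hM.2 f (hf M hM) g (hg M hM)).2⟩

theorem subset_generatedSublattice {V : Type*} [AddCommGroup V] [Module ℝ V]
    [Lattice V] (S : Set V) : S ⊆ generatedSublattice S := by
  intro f hf
  simp only [generatedSublattice, SetLike.mem_coe, Submodule.mem_sInf]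
  exact fun M hM => hM.1 hf

section

variable (E : Type*) [NormedAddCommGroup E] [NormedSpace ℝ E]

/-- The evaluation functional `x̂ : E* → ℝ`, `x̂(x*) = x*(x)`. -/
def evalFun (x : E) : StrongDual ℝ E → ℝ := fun φ => φ x

/-- The sublattice `L` of `ℝ^{E*}` (with pointwise operations) generated by the evaluation
functionals `x̂`, `x ∈ E`. -/
def evalLattice : Submodule ℝ (StrongDual ℝ E → ℝ) :=
  generatedSublattice (Set.range (evalFun E))

/-- The lattice operations of `L` are those of `ℝ^{E*}`, that is, pointwise. -/
instance : Lattice (evalLattice E) :=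
  Subtype.lattice
    (fun _ _ hf hg => (isVectorSublattice_generatedSublattice _ _ hf _ hg).1)
    (fun _ _ hf hg => (isVectorSublattice_generatedSublattice _ _ hf _ hg).2)

/-- The linear map `E → L`, `x ↦ x̂`. -/
def hat : E →ₗ[ℝ] evalLattice E where
  toFun x := ⟨evalFun E x, subset_generatedSublattice _ ⟨x, rfl⟩⟩
  map_add' x y := by
    ext φ
    simp [evalFun]
  map_smul' c x := by
    ext φ
    simp [evalFun]

end

/-- `X`, together with `ι : V → X`, is a completion of the vector lattice `V` with respect to the
lattice norm `p`: `X` is a Banach lattice and `ι` is an isometric lattice homomorphism with dense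
range. -/
structure IsLatticeCompletion {V : Type*} [AddCommGroup V] [Module ℝ V] [Lattice V]
    (p : Seminorm ℝ V) (X : Type*) [NormedAddCommGroup X] [NormedSpace ℝ X] [Lattice X]
    (ι : V →ₗ[ℝ] X) : Prop where
  isBanachLattice : IsBanachLattice X
  isLatticeHom : IsLatticeHom ι
  norm_map : ∀ f : V, ‖ι f‖ = p f
  denseRange : DenseRange ι

/-- `X`, together with `j : E → X`, is the free Banach lattice `FBL[E]`: `j` identifies `E`
isometrically with a closed subspace of the Banach lattice `X`, and every bounded operator `T` from
`E` into a Banach lattice `Y` extends to a bounded lattice homomorphism on `X` with the same norm,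
this being the only (linear) lattice homomorphism `X → Y` at all that extends `T`. -/
structure IsFreeBanachLattice (E : Type u) [NormedAddCommGroup E] [NormedSpace ℝ E]
    (X : Type v) [NormedAddCommGroup X] [NormedSpace ℝ X] [Lattice X]
    (j : E →ₗ[ℝ] X) : Prop where
  isBanachLattice : IsBanachLattice X
  norm_map : ∀ x : E, ‖j x‖ = ‖x‖
  isClosed_range : IsClosed (Set.range j)
  exists_unique_extension : ∀ (Y : Type w) [NormedAddCommGroup Y] [NormedSpace ℝ Y] [Lattice Y]
    [IsBanachLattice Y] (T : E →L[ℝ] Y),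
    ∃ S : X →L[ℝ] Y,
      IsLatticeHom (S : X →ₗ[ℝ] Y) ∧ (∀ x : E, S (j x) = T x) ∧ ‖S‖ = ‖T‖ ∧
      ∀ R : X →ₗ[ℝ] Y, IsLatticeHom R → (∀ x : E, R (j x) = T x) → R = (S : X →ₗ[ℝ] Y)

end FreeBanachLattice

/-! The algebraic heart is that `L` is the free vector lattice over the vector space `E`: every
linear `T : E → Y` into a vector lattice extends to a lattice homomorphism on `L`
(`exists_latticeHom_extension`). If `sup x̂ᵢ ≤ sup ŷⱼ` pointwise on `E*`, Hahn–Banach puts each `xᵢ`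
in the convex hull of the `yⱼ`, so `T xᵢ ≤ sup T yⱼ`. Since elements of `L` are differences of such
suprema, the extension is well defined.

The norm `ν` is the supremum of all admissible seminorms. Pulling a norm back along a lattice
homomorphism gives, after scaling, an admissible seminorm, so `ν` controls every such homomorphism
(`norm_map_le_mul_freeNorm`). Applied to point evaluations this shows that `ν` is a norm extending
that of `E`; applied to the extension of `T` it gives the bound `‖T‖`, and density carries the map
to the completion. Uniqueness among unbounded homomorphisms holds because positive operators on a
Banach lattice are continuous (`exists_bound_of_monotone`). -/

namespace FreeBanachLattice

section VectorLattice

variable {V W : Type*} [AddCommGroup V] [Module ℝ V] [Lattice V] [AddCommGroup W] [Module ℝ W]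
  [Lattice W]

theorem smul_sup_of_nonneg [IsOrderedModule ℝ V] {r : ℝ} (hr : 0 ≤ r) (a b : V) :
    r • (a ⊔ b) = r • a ⊔ r • b := by
  rcases hr.eq_or_lt with rfl | hr
  · simp
  · exact (OrderIso.smulRight hr).map_sup a b

theorem generatedSublattice_le {S : Set V} {M : Submodule ℝ V} (hS : S ⊆ M)
    (hM : IsVectorSublattice M) : generatedSublattice S ≤ M :=
  sInf_le ⟨hS, hM⟩

theorem IsLatticeHom.map_abs {T : V →ₗ[ℝ] W} (hT : IsLatticeHom T) (a : V) : T |a| = |T a| := by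
  simp [abs, (hT _ _).1]

theorem IsLatticeHom.monotone {T : V →ₗ[ℝ] W} (hT : IsLatticeHom T) : Monotone T := by
  intro a b hab
  have := (hT a b).1
  rw [sup_eq_right.2 hab] at this
  exact sup_eq_right.1 this.symm

theorem isVectorSublattice_map_fst {G : Submodule ℝ (V × W)} (hG : IsVectorSublattice G) :
    IsVectorSublattice (G.map (LinearMap.fst ℝ V W)) := by
  rintro _ ⟨f, hf, rfl⟩ _ ⟨g, hg, rfl⟩
  exact ⟨⟨f ⊔ g, (hG f hf g hg).1, rfl⟩, ⟨f ⊓ g, (hG f hf g hg).2, rfl⟩⟩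

end VectorLattice

/-! ### Normal form in generated sublattices -/

section Generated

variable {V : Type*} [AddCommGroup V] [Module ℝ V] [Lattice V] [IsOrderedAddMonoid V]

theorem add_mem_supClosure {D : Submodule ℝ V} {a b : V} (ha : a ∈ supClosure (D : Set V))
    (hb : b ∈ supClosure (D : Set V)) : a + b ∈ supClosure (D : Set V) := by
  have hD : ∀ d ∈ D, ∀ b ∈ supClosure (D : Set V), d + b ∈ supClosure (D : Set V) := by
    intro d hd
    refine supClosure_min (t := {b | d + b ∈ supClosure (D : Set V)})
      (fun c hc => subset_supClosure (D.add_mem hd hc)) fun x hx y hy => ?_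
    simpa only [Set.mem_ofPred_eq, add_sup] using supClosed_supClosure hx hy
  refine supClosure_min (t := {a | a + b ∈ supClosure (D : Set V)}) (fun d hd => hD d hd b hb)
    (fun x hx y hy => ?_) ha
  simpa only [Set.mem_ofPred_eq, sup_add] using supClosed_supClosure hx hy

omit [IsOrderedAddMonoid V] in
theorem smul_mem_supClosure [IsOrderedModule ℝ V] {D : Submodule ℝ V} {r : ℝ} (hr : 0 ≤ r) {a : V}
    (ha : a ∈ supClosure (D : Set V)) : r • a ∈ supClosure (D : Set V) := by
  refine supClosure_min (t := {a | r • a ∈ supClosure (D : Set V)})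
    (fun d hd => subset_supClosure (D.smul_mem r hd)) (fun x hx y hy => ?_) ha
  simpa only [Set.mem_ofPred_eq, smul_sup_of_nonneg hr] using supClosed_supClosure hx hy

/-- Every element of the sublattice generated by a subspace is a difference of two finite suprema
of elements of the subspace. -/
theorem exists_sub_of_mem_generatedSublattice [IsOrderedModule ℝ V] {D : Submodule ℝ V} {f : V}
    (hf : f ∈ generatedSublattice (D : Set V)) :
    ∃ a ∈ supClosure (D : Set V), ∃ b ∈ supClosure (D : Set V), f = a - b := by
  let M : Submodule ℝ V :=
    { carrier := {f | ∃ a ∈ supClosure (D : Set V), ∃ b ∈ supClosure (D : Set V), f = a - b}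
      add_mem' := by
        rintro _ _ ⟨a, ha, b, hb, rfl⟩ ⟨c, hc, d, hd, rfl⟩
        exact ⟨a + c, add_mem_supClosure ha hc, b + d, add_mem_supClosure hb hd, by abel⟩
      zero_mem' := ⟨0, subset_supClosure D.zero_mem, 0, subset_supClosure D.zero_mem, by simp⟩
      smul_mem' := by
        rintro r _ ⟨a, ha, b, hb, rfl⟩
        rcases le_total 0 r with hr | hr
        · exact ⟨r • a, smul_mem_supClosure hr ha, r • b, smul_mem_supClosure hr hb,
            smul_sub r a b⟩
        · refine ⟨(-r) • b, smul_mem_supClosure (neg_nonneg.2 hr) hb, (-r) • a,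
            smul_mem_supClosure (neg_nonneg.2 hr) ha, ?_⟩
          module }
  have hsup : ∀ f ∈ M, ∀ g ∈ M, f ⊔ g ∈ M := by
    rintro _ ⟨a, ha, b, hb, rfl⟩ _ ⟨c, hc, d, hd, rfl⟩
    -- Add `b + d` to both `a - b` and `c - d`: the supremum is then taken between sums from the
    -- sup-closure.
    refine ⟨(a + d) ⊔ (c + b), supClosed_supClosure (add_mem_supClosure ha hd)
      (add_mem_supClosure hc hb), b + d, add_mem_supClosure hb hd, ?_⟩
    rw [sub_eq_add_neg ((a + d) ⊔ (c + b)), sup_add]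
    congr 1 <;> abel
  have hM : IsVectorSublattice M := by
    refine fun f hf g hg => ⟨hsup f hf g hg, ?_⟩
    have := M.neg_mem (hsup _ (M.neg_mem hf) _ (M.neg_mem hg))
    rwa [neg_sup, neg_neg, neg_neg] at this
  exact Submodule.mem_sInf.1 hf M ⟨fun d hd => ⟨d, subset_supClosure hd, 0,
    subset_supClosure D.zero_mem, (sub_zero d).symm⟩, hM⟩

end Generated

/-! ### Freeness of `L` as a vector lattice -/

section EvalLattice

variable {E : Type*} [NormedAddCommGroup E] [NormedSpace ℝ E]

instance : IsOrderedAddMonoid (evalLattice E) where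
  add_le_add_left a b h c := fun φ => by
    have := h φ
    simpa using this

instance : IsOrderedModule ℝ (evalLattice E) where
  smul_le_smul_of_nonneg_left _ hr _ _ h := fun φ => mul_le_mul_of_nonneg_left (h φ) hr
  smul_le_smul_of_nonneg_right _ ha _ _ h := fun φ => mul_le_mul_of_nonneg_right h (ha φ)

theorem eq_top_of_hat_mem {M : Submodule ℝ (evalLattice E)} (hM : IsVectorSublattice M)
    (h : ∀ x, hat E x ∈ M) : M = ⊤ := by
  have key : evalLattice E ≤ M.map (evalLattice E).subtype := by
    refine generatedSublattice_le ?_ ?_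
    · rintro _ ⟨x, rfl⟩
      exact ⟨hat E x, h x, rfl⟩
    · rintro _ ⟨f, hf, rfl⟩ _ ⟨g, hg, rfl⟩
      exact ⟨⟨f ⊔ g, (hM f hf g hg).1, rfl⟩, ⟨f ⊓ g, (hM f hf g hg).2, rfl⟩⟩
  refine eq_top_iff.2 fun f _ => ?_
  obtain ⟨g, hg, hgf⟩ := key f.2
  rwa [← Subtype.ext hgf]

theorem latticeHom_ext {Y : Type*} [AddCommGroup Y] [Module ℝ Y] [Lattice Y]
    {R S : evalLattice E →ₗ[ℝ] Y} (hR : IsLatticeHom R) (hS : IsLatticeHom S)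
    (h : ∀ x, R (hat E x) = S (hat E x)) : R = S := by
  refine LinearMap.eqLocus_eq_top.1 (eq_top_of_hat_mem (fun f hf g hg => ?_) h)
  simp only [LinearMap.mem_eqLocus] at *
  rw [(hR f g).1, (hR f g).2, (hS f g).1, (hS f g).2, hf, hg]
  exact ⟨rfl, rfl⟩

/-- The hull of a finite set is compact, hence closed, so a point outside it is strictly separated
by some functional. -/
theorem mem_convexHull_of_forall_exists_le {t : Set E} (ht : t.Finite) {x : E}
    (h : ∀ φ : StrongDual ℝ E, ∃ y ∈ t, φ x ≤ φ y) : x ∈ convexHull ℝ t := by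
  by_contra hx
  obtain ⟨φ, u, hφ, hu⟩ := geometric_hahn_banach_closed_point (convex_convexHull ℝ t)
    (ht.isCompact_convexHull ℝ).isClosed hx
  obtain ⟨y, hy, hxy⟩ := h φ
  exact (hu.trans_le hxy).not_gt (hφ y (subset_convexHull ℝ t hy))

section Lift

variable {Y : Type*} [AddCommGroup Y] [Module ℝ Y] [Lattice Y] [IsOrderedAddMonoid Y]
  [IsOrderedModule ℝ Y]

/-- The linear map `x ↦ (x̂, T x)`. -/
def hatGraph (T : E →ₗ[ℝ] Y) : E →ₗ[ℝ] (StrongDual ℝ E → ℝ) × Y :=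
  ((evalLattice E).subtype ∘ₗ hat E).prod T

/-- An inequality between suprema of evaluations is transported by `T`, because it amounts to
convex-hull membership and order intervals `Iic` are convex. -/
theorem snd_le_snd_of_mem_supClosure (T : E →ₗ[ℝ] Y) {p q : (StrongDual ℝ E → ℝ) × Y}
    (hp : p ∈ supClosure (LinearMap.range (hatGraph T) : Set ((StrongDual ℝ E → ℝ) × Y)))
    (hq : q ∈ supClosure (LinearMap.range (hatGraph T) : Set ((StrongDual ℝ E → ℝ) × Y))) (h : p.1 ≤ q.1) :
    p.2 ≤ q.2 := by
  -- The set `t` collects the points whose evaluations make up the supremum `q.1`; only these two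
  -- bounds are needed of it.
  have hq' : ∃ t : Set E, t.Finite ∧ (∀ φ : StrongDual ℝ E, ∃ y ∈ t, q.1 φ ≤ φ y) ∧
      ∀ y ∈ t, T y ≤ q.2 := by
    refine supClosure_min (t := {q | ∃ t : Set E, t.Finite ∧
      (∀ φ : StrongDual ℝ E, ∃ y ∈ t, q.1 φ ≤ φ y) ∧ ∀ y ∈ t, T y ≤ q.2}) ?_ ?_ hq
    · rintro _ ⟨x, rfl⟩
      exact ⟨{x}, Set.finite_singleton x, fun φ => ⟨x, rfl, le_rfl⟩, by
        rintro _ rfl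
        exact le_rfl⟩
    · rintro a ⟨s, hs, hsa, hsa'⟩ b ⟨t, ht, htb, htb'⟩
      refine ⟨s ∪ t, hs.union ht, fun φ => ?_, ?_⟩
      · obtain ⟨y, hy, hya⟩ := hsa φ
        obtain ⟨z, hz, hzb⟩ := htb φ
        rcases le_total (a.1 φ) (b.1 φ) with hab | hab
        · exact ⟨z, Or.inr hz, (sup_le hab le_rfl).trans hzb⟩
        · exact ⟨y, Or.inl hy, (sup_le le_rfl hab).trans hya⟩
      · rintro y (hy | hy)
        · exact (hsa' y hy).trans le_sup_left
        · exact (htb' y hy).trans le_sup_right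
  obtain ⟨t, ht, hqt, htq⟩ := hq'
  have hx : ∀ x : E, evalFun E x ≤ q.1 → T x ≤ q.2 := fun x hx => by
    have hmem : x ∈ convexHull ℝ t := mem_convexHull_of_forall_exists_le ht fun φ => by
      obtain ⟨y, hy, hle⟩ := hqt φ
      exact ⟨y, hy, (hx φ).trans hle⟩
    exact convexHull_min (s := t) (t := T ⁻¹' Set.Iic q.2) htq
      ((convex_Iic q.2).linear_preimage T) hmem
  refine supClosure_min (t := {p | p.1 ≤ q.1 → p.2 ≤ q.2}) ?_ ?_ hp h
  · rintro _ ⟨x, rfl⟩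
    exact hx x
  · intro a ha b hb hab
    exact sup_le (ha (le_sup_left.trans hab)) (hb (le_sup_right.trans hab))

instance : IsOrderedModule ℝ ((StrongDual ℝ E → ℝ) × Y) where
  smul_le_smul_of_nonneg_left _ hr _ _ h :=
    ⟨smul_le_smul_of_nonneg_left h.1 hr, smul_le_smul_of_nonneg_left h.2 hr⟩
  smul_le_smul_of_nonneg_right _ ha _ _ h :=
    ⟨smul_le_smul_of_nonneg_right h ha.1, smul_le_smul_of_nonneg_right h ha.2⟩

/-- Every linear map from `E` to a vector lattice extends to a lattice homomorphism on `L`. -/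
theorem exists_latticeHom_extension (T : E →ₗ[ℝ] Y) :
    ∃ S : evalLattice E →ₗ[ℝ] Y, IsLatticeHom S ∧ ∀ x, S (hat E x) = T x := by
  set G := generatedSublattice (LinearMap.range (hatGraph T) : Set ((StrongDual ℝ E → ℝ) × Y)) with hGdef
  have hG : IsVectorSublattice G := isVectorSublattice_generatedSublattice _
  have hT : ∀ x, hatGraph T x ∈ G := fun x => subset_generatedSublattice _ ⟨x, rfl⟩
  -- Applied to a difference and its negative, this makes `G` the graph of a function.
  have hnonpos : ∀ p ∈ G, p.1 ≤ 0 → p.2 ≤ 0 := by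
    intro p hp h
    obtain ⟨a, ha, b, hb, rfl⟩ := exists_sub_of_mem_generatedSublattice hp
    exact sub_nonpos.2 (snd_le_snd_of_mem_supClosure T ha hb (sub_nonpos.1 h))
  have huniq : ∀ p ∈ G, ∀ q ∈ G, p.1 = q.1 → p.2 = q.2 := by
    intro p hp q hq h
    exact le_antisymm (sub_nonpos.1 (hnonpos _ (G.sub_mem hp hq) (sub_nonpos.2 h.le)))
      (sub_nonpos.1 (hnonpos _ (G.sub_mem hq hp) (sub_nonpos.2 h.ge)))
  have hex : ∀ f : evalLattice E, ∃ y, ((f : StrongDual ℝ E → ℝ), y) ∈ G := by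
    intro f
    have hle : evalLattice E ≤ G.map (LinearMap.fst ℝ _ Y) := by
      refine generatedSublattice_le ?_ (isVectorSublattice_map_fst hG)
      rintro _ ⟨x, rfl⟩
      exact ⟨hatGraph T x, hT x, rfl⟩
    obtain ⟨p, hp, hpf⟩ := hle f.2
    exact ⟨p.2, hpf ▸ hp⟩
  choose S hS using hex
  refine ⟨⟨⟨S, fun f g => ?_⟩, fun r f => ?_⟩, fun f g => ⟨?_, ?_⟩, fun x => ?_⟩
  · exact huniq _ (hS _) _ (G.add_mem (hS f) (hS g)) rfl
  · exact huniq _ (hS _) _ (G.smul_mem r (hS f)) rfl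
  · exact huniq _ (hS _) _ (hG _ (hS f) _ (hS g)).1 rfl
  · exact huniq _ (hS _) _ (hG _ (hS f) _ (hS g)).2 rfl
  · exact huniq _ (hS _) _ (hT x) rfl

end Lift

end EvalLattice

/-! ### The completion of a normed lattice -/

section Completion

open UniformSpace UniformSpace.Completion

variable {V : Type*} [NormedAddCommGroup V] [Lattice V]

/-- `map₂` is continuous in any case, but it extends `⊔` only once `⊔` is known to be uniformly
continuous. -/
noncomputable instance : Max (Completion V) := ⟨Completion.map₂ (· ⊔ ·)⟩

noncomputable instance : Min (Completion V) := ⟨Completion.map₂ (· ⊓ ·)⟩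

@[fun_prop]
theorem continuous_completion_sup {X : Type*} [TopologicalSpace X] {f g : X → Completion V}
    (hf : Continuous f) (hg : Continuous g) : Continuous fun x => f x ⊔ g x :=
  continuous_map₂ hf hg

@[fun_prop]
theorem continuous_completion_inf {X : Type*} [TopologicalSpace X] {f g : X → Completion V}
    (hf : Continuous f) (hg : Continuous g) : Continuous fun x => f x ⊓ g x :=
  continuous_map₂ hf hg

variable [IsOrderedAddMonoid V] [HasSolidNorm V]

theorem uniformContinuous₂_sup : UniformContinuous₂ ((· ⊔ ·) : V → V → V) := by
  refine (LipschitzWith.of_dist_le_mul (K := 2) fun p q => ?_).uniformContinuous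
  simp only [dist_eq_norm, Function.uncurry, NNReal.coe_ofNat]
  have h1 : ‖p.1 - q.1‖ ≤ ‖p - q‖ := norm_fst_le (p - q)
  have h2 : ‖p.2 - q.2‖ ≤ ‖p - q‖ := norm_snd_le (p - q)
  linarith [norm_sup_sub_sup_le_add_norm p.1 p.2 q.1 q.2]

theorem uniformContinuous₂_inf : UniformContinuous₂ ((· ⊓ ·) : V → V → V) := by
  refine (LipschitzWith.of_dist_le_mul (K := 2) fun p q => ?_).uniformContinuous
  simp only [dist_eq_norm, Function.uncurry, NNReal.coe_ofNat]
  have h1 : ‖p.1 - q.1‖ ≤ ‖p - q‖ := norm_fst_le (p - q)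
  have h2 : ‖p.2 - q.2‖ ≤ ‖p - q‖ := norm_snd_le (p - q)
  linarith [norm_inf_sub_inf_le_add_norm p.1 p.2 q.1 q.2]

theorem coe_sup (a b : V) : ((a ⊔ b : V) : Completion V) = (a : Completion V) ⊔ b :=
  (map₂_coe_coe a b _ uniformContinuous₂_sup).symm

theorem coe_inf (a b : V) : ((a ⊓ b : V) : Completion V) = (a : Completion V) ⊓ b :=
  (map₂_coe_coe a b _ uniformContinuous₂_inf).symm

/-- Equational axioms pass to the completion by density; the order is then recovered from `⊔`. -/
noncomputable instance : Lattice (Completion V) :=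
  Lattice.mk'
    (fun a b => Completion.induction_on₂ a b (isClosed_eq (by fun_prop) (by fun_prop))
      fun a b => by rw [← coe_sup, ← coe_sup, sup_comm])
    (fun a b c => Completion.induction_on₃ a b c (isClosed_eq (by fun_prop) (by fun_prop))
      fun a b c => by simp only [← coe_sup, sup_assoc])
    (fun a b => Completion.induction_on₂ a b (isClosed_eq (by fun_prop) (by fun_prop))
      fun a b => by rw [← coe_inf, ← coe_inf, inf_comm])
    (fun a b c => Completion.induction_on₃ a b c (isClosed_eq (by fun_prop) (by fun_prop))
      fun a b c => by simp only [← coe_inf, inf_assoc])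
    (fun a b => Completion.induction_on₂ a b (isClosed_eq (by fun_prop) (by fun_prop))
      fun a b => by rw [← coe_inf, ← coe_sup, sup_inf_self])
    (fun a b => Completion.induction_on₂ a b (isClosed_eq (by fun_prop) (by fun_prop))
      fun a b => by rw [← coe_sup, ← coe_inf, inf_sup_self])

theorem completion_add_sup (c a b : Completion V) : c + a ⊔ b = (c + a) ⊔ (c + b) :=
  Completion.induction_on₃ c a b
    (isClosed_eq (by fun_prop)
      (continuous_completion_sup (f := fun p : Completion V × Completion V × Completion V => p.1 + p.2.1)
        (g := fun p => p.1 + p.2.2)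
        (by fun_prop) (by fun_prop)))
    fun c a b => by simp only [← coe_sup, ← coe_add, add_sup]

instance : IsOrderedAddMonoid (Completion V) where
  add_le_add_left a b h c := by
    rw [← sup_eq_right] at h ⊢
    rw [add_comm a, add_comm b, ← completion_add_sup, h]

theorem norm_completion_abs (a : Completion V) : ‖a ⊔ -a‖ = ‖a‖ :=
  Completion.induction_on a (isClosed_eq (by fun_prop) (by fun_prop)) fun a => by
    rw [← coe_neg, ← coe_sup, norm_coe, norm_coe]
    exact norm_abs_eq_norm a

/-- Solidity in unconditional form: the hypothesis `|a| ≤ |b|` does not pass directly to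
approximants, whereas this inequality holds for all pairs and is closed. -/
theorem norm_completion_abs_inf_abs_le (a b : Completion V) :
    ‖(a ⊔ -a) ⊓ (b ⊔ -b)‖ ≤ ‖b‖ :=
  Completion.induction_on₂ a b
    (isClosed_le
      (f := fun p : Completion V × Completion V => ‖(p.1 ⊔ -p.1) ⊓ (p.2 ⊔ -p.2)‖)
      (g := fun p => ‖p.2‖) (by fun_prop) (by fun_prop)) fun a b => by
    rw [← coe_neg, ← coe_neg, ← coe_sup, ← coe_sup, ← coe_inf, norm_coe, norm_coe]
    refine HasSolidNorm.solid (?_ : |(|a| ⊓ |b|)| ≤ |b|)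
    rw [abs_of_nonneg (le_inf (abs_nonneg a) (abs_nonneg b))]
    exact inf_le_right

instance : HasSolidNorm (Completion V) where
  solid a b h := by
    have key := norm_completion_abs_inf_abs_le a b
    rwa [inf_eq_left.2 (show a ⊔ -a ≤ b ⊔ -b from h), norm_completion_abs] at key

variable [NormedSpace ℝ V] [IsOrderedModule ℝ V]

theorem completion_smul_sup {r : ℝ} (hr : 0 ≤ r) (a b : Completion V) :
    r • (a ⊔ b) = r • a ⊔ r • b := by
  refine Completion.induction_on₂ a b
    (isClosed_eq ((continuous_completion_sup continuous_fst continuous_snd).const_smul r)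
      (continuous_completion_sup (continuous_fst.const_smul r) (continuous_snd.const_smul r)))
    fun a b => ?_
  rw [← coe_sup, ← Completion.coe_smul, ← Completion.coe_smul, ← Completion.coe_smul, ← coe_sup,
    smul_sup_of_nonneg hr]

instance : IsOrderedModule ℝ (Completion V) where
  smul_le_smul_of_nonneg_left r hr a b h := by
    rw [← sup_eq_right] at h ⊢
    rw [← completion_smul_sup hr, h]
  smul_le_smul_of_nonneg_right a ha r s h := by
    have key := completion_smul_sup (sub_nonneg.2 h) a 0
    rw [sup_eq_left.2 ha, smul_zero] at key
    rw [← sub_nonneg, ← sub_smul]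
    exact sup_eq_left.1 key.symm

instance : IsBanachLattice (Completion V) where

end Completion

theorem exists_isLatticeCompletion {V : Type u} [AddCommGroup V] [Module ℝ V] [Lattice V]
    [IsOrderedAddMonoid V] [IsOrderedModule ℝ V] {p : Seminorm ℝ V} (hp : IsLatticeSeminorm p)
    (hp0 : ∀ f, p f = 0 → f = 0) :
    ∃ (X : Type u) (_ : NormedAddCommGroup X) (_ : NormedSpace ℝ X) (_ : Lattice X)
      (ι : V →ₗ[ℝ] X), IsLatticeCompletion p X ι := by
  let : NormedAddCommGroup V := AddGroupNorm.toNormedAddCommGroup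
    { p.toAddGroupSeminorm with eq_zero_of_map_eq_zero' := hp0 }
  let : NormedSpace ℝ V := ⟨fun r f => (map_smul_eq_mul p r f).le⟩
  have : HasSolidNorm V := ⟨hp⟩
  exact ⟨UniformSpace.Completion V, inferInstance, inferInstance, inferInstance,
    UniformSpace.Completion.toComplₗᵢ.toLinearMap, inferInstance,
    fun f g => ⟨coe_sup f g, coe_inf f g⟩, UniformSpace.Completion.norm_coe,
    UniformSpace.Completion.denseRange_coe⟩

/-! ### Automatic continuity of positive operators -/

section Positive

variable {X Y : Type*} [NormedAddCommGroup X] [NormedSpace ℝ X] [Lattice X] [IsBanachLattice X]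
  [NormedAddCommGroup Y] [NormedSpace ℝ Y] [Lattice Y] [HasSolidNorm Y]

omit [IsBanachLattice X] in
theorem norm_map_le_norm_map_of_monotone {R : X →ₗ[ℝ] Y} (hR : Monotone R) {x y : X}
    (h : |x| ≤ y) : ‖R x‖ ≤ ‖R y‖ := by
  have hxy : |R x| ≤ R y := by
    refine sup_le (hR ((le_abs_self x).trans h)) ?_
    rw [← map_neg]
    exact hR ((neg_le_abs x).trans h)
  exact norm_le_norm_of_abs_le_abs (hxy.trans (le_abs_self _))

/-- Positive operators on a Banach lattice are bounded. -/
theorem exists_bound_of_monotone {R : X →ₗ[ℝ] Y} (hR : Monotone R) :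
    ∃ C, ∀ x, ‖R x‖ ≤ C * ‖x‖ := by
  by_contra! h
  -- Of `4 ^ n = 2 ^ n * 2 ^ n`, one factor makes the series of the `y n` converge, the other makes
  -- `‖R (y n)‖` unbounded.
  choose x hx using fun n : ℕ => h (4 ^ n)
  have hx0 : ∀ n, 0 < ‖x n‖ := fun n => norm_pos_iff.2 fun h0 => by
    simpa [h0] using hx n
  set y : ℕ → X := fun n => (2 ^ n * ‖x n‖)⁻¹ • |x n| with hy
  have hpos : ∀ n, (0 : ℝ) < 2 ^ n * ‖x n‖ := fun n => mul_pos (by positivity) (hx0 n)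
  have hy0 : ∀ n, 0 ≤ y n := fun n => smul_nonneg (inv_nonneg.2 (hpos n).le) (abs_nonneg _)
  have hynorm : ∀ n, ‖y n‖ = (1 / 2) ^ n := fun n => by
    rw [hy, norm_smul, norm_abs_eq_norm, norm_inv, Real.norm_of_nonneg (hpos n).le, mul_inv,
      mul_assoc, inv_mul_cancel₀ (hx0 n).ne', one_div, inv_pow, mul_one]
  have hsum : Summable y := Summable.of_norm (by
    simpa only [hynorm] using summable_geometric_two)
  have hbig : ∀ n, (2 : ℝ) ^ n ≤ ‖R (∑' n, y n)‖ := fun n => by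
    have h1 : ‖R (y n)‖ ≤ ‖R (∑' n, y n)‖ := norm_map_le_norm_map_of_monotone hR (by
      rw [abs_of_nonneg (hy0 n)]
      exact hsum.le_tsum n fun m _ => hy0 m)
    refine le_trans ?_ h1
    rw [hy, map_smul, norm_smul, norm_inv, Real.norm_of_nonneg (hpos n).le, inv_mul_eq_div,
      le_div_iff₀ (hpos n), ← mul_assoc, ← mul_pow]
    norm_num only
    exact (hx n).le.trans (norm_map_le_norm_map_of_monotone hR le_rfl)
  obtain ⟨n, hn⟩ := pow_unbounded_of_one_lt ‖R (∑' n, y n)‖ (one_lt_two (α := ℝ))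
  exact (hbig n).not_gt hn

end Positive

section LatticeSeminorm

variable {V : Type*} [AddCommGroup V] [Module ℝ V] [Lattice V] [IsOrderedAddMonoid V]
  {p : Seminorm ℝ V}

theorem IsLatticeSeminorm.map_sup_le (hp : IsLatticeSeminorm p) (f g : V) :
    p (f ⊔ g) ≤ p f + p g := by
  have habs : ∀ f, p |f| = p f := fun f => (hp _ _ (abs_abs f).le).antisymm (hp _ _ (abs_abs f).ge)
  rw [← habs f, ← habs g]
  refine (hp _ _ ?_).trans (map_add_le_add p _ _)
  rw [abs_of_nonneg (add_nonneg (abs_nonneg f) (abs_nonneg g))]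
  refine sup_le (sup_le ?_ ?_) ?_
  · exact (le_abs_self f).trans (le_add_of_nonneg_right (abs_nonneg g))
  · exact (le_abs_self g).trans (le_add_of_nonneg_left (abs_nonneg f))
  · rw [neg_sup]
    exact inf_le_left.trans ((neg_le_abs f).trans (le_add_of_nonneg_right (abs_nonneg g)))

theorem IsLatticeSeminorm.map_inf_le (hp : IsLatticeSeminorm p) (f g : V) :
    p (f ⊓ g) ≤ p f + p g := by
  have h := hp.map_sup_le (-f) (-g)
  rwa [← neg_inf, map_neg_eq_map, map_neg_eq_map, map_neg_eq_map] at h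

omit [IsOrderedAddMonoid V] in
theorem isLatticeSeminorm_sSup {A : Set (Seminorm ℝ V)} (hA : BddAbove A)
    (h : ∀ p ∈ A, IsLatticeSeminorm p) : IsLatticeSeminorm (sSup A) := by
  intro f g hfg
  rw [Seminorm.sSup_apply hA, Seminorm.sSup_apply hA]
  obtain ⟨q, hq⟩ := hA
  exact ciSup_mono ⟨q g, Set.forall_mem_range.2 fun p => hq p.2 g⟩ fun p => h p p.2 f g hfg

end LatticeSeminorm

/-! ### The largest lattice seminorm and the universal property -/

section FreeNorm

variable (E : Type*) [NormedAddCommGroup E] [NormedSpace ℝ E]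

/-- The lattice seminorms `p` on `L` with `p(x̂) ≤ ‖x‖` for all `x`. -/
def admissibleSeminorms : Set (Seminorm ℝ (evalLattice E)) :=
  {p | IsLatticeSeminorm p ∧ ∀ x : E, p (hat E x) ≤ ‖x‖}

/-- The elements with a bound uniform in `p` form a vector sublattice containing every `x̂`, hence
all of `L`. -/
theorem bddAbove_admissibleSeminorms : BddAbove (admissibleSeminorms E) := by
  let M : Submodule ℝ (evalLattice E) :=
    { carrier := {f | ∃ C, ∀ p ∈ admissibleSeminorms E, p f ≤ C}
      add_mem' := by
        rintro f g ⟨C, hC⟩ ⟨D, hD⟩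
        exact ⟨C + D, fun p hp => (map_add_le_add p f g).trans (add_le_add (hC p hp) (hD p hp))⟩
      zero_mem' := ⟨0, fun p _ => (map_zero p).le⟩
      smul_mem' := by
        rintro r f ⟨C, hC⟩
        refine ⟨‖r‖ * C, fun p hp => ?_⟩
        rw [map_smul_eq_mul]
        exact mul_le_mul_of_nonneg_left (hC p hp) (norm_nonneg r) }
  have hM : IsVectorSublattice M := by
    rintro f ⟨C, hC⟩ g ⟨D, hD⟩
    exact ⟨⟨C + D, fun p hp => (hp.1.map_sup_le f g).trans (add_le_add (hC p hp) (hD p hp))⟩,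
      ⟨C + D, fun p hp => (hp.1.map_inf_le f g).trans (add_le_add (hC p hp) (hD p hp))⟩⟩
  have htop : M = ⊤ := eq_top_of_hat_mem hM fun x => ⟨‖x‖, fun p hp => hp.2 x⟩
  have hbdd : ∀ f, ∃ C, ∀ p ∈ admissibleSeminorms E, p f ≤ C := fun f =>
    (htop ▸ Submodule.mem_top : f ∈ M)
  choose C hC using hbdd
  exact Seminorm.bddAbove_iff.2 ⟨C, Set.forall_mem_image.2 fun p hp f => hC f p hp⟩

/-- The largest lattice seminorm on `L` with `ν(x̂) ≤ ‖x‖`. -/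
noncomputable def freeNorm : Seminorm ℝ (evalLattice E) := sSup (admissibleSeminorms E)

theorem isGreatest_freeNorm : IsGreatest (admissibleSeminorms E) (freeNorm E) := by
  have hbdd := bddAbove_admissibleSeminorms E
  refine ⟨⟨isLatticeSeminorm_sSup hbdd fun p hp => hp.1, fun x => ?_⟩,
    fun p hp => le_csSup hbdd hp⟩
  rw [freeNorm, Seminorm.sSup_apply hbdd]
  exact Real.iSup_le (fun p => p.2.2 x) (norm_nonneg x)

variable {E}

/-- `S` preserves `|·|` and order, so `f ↦ c⁻¹ * ‖S f‖` is admissible and lies below the largest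
seminorm. -/
theorem norm_map_le_mul_freeNorm {Y : Type*} [NormedAddCommGroup Y] [NormedSpace ℝ Y] [Lattice Y]
    [HasSolidNorm Y] [IsOrderedAddMonoid Y] {S : evalLattice E →ₗ[ℝ] Y} (hS : IsLatticeHom S)
    {c : NNReal} (hc : 0 < c) (h : ∀ x, ‖S (hat E x)‖ ≤ c * ‖x‖) (f : evalLattice E) :
    ‖S f‖ ≤ c * freeNorm E f := by
  have hp : c⁻¹ • (normSeminorm ℝ Y).comp S ∈ admissibleSeminorms E := by
    refine ⟨fun f g hfg => ?_, fun x => ?_⟩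
    · refine mul_le_mul_of_nonneg_left (HasSolidNorm.solid ?_) (c⁻¹).2
      rw [← hS.map_abs, ← hS.map_abs]
      exact hS.monotone hfg
    · change (c⁻¹ : ℝ) * ‖S (hat E x)‖ ≤ ‖x‖
      exact (inv_mul_le_iff₀ (NNReal.coe_pos.2 hc)).2 (h x)
  exact (inv_mul_le_iff₀ (NNReal.coe_pos.2 hc)).1 ((isGreatest_freeNorm E).2 hp f)

/-- Evaluation at a functional, as a linear map on `L`. -/
def evalAt (φ : StrongDual ℝ E) : evalLattice E →ₗ[ℝ] ℝ :=
  LinearMap.proj φ ∘ₗ (evalLattice E).subtype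

theorem isLatticeHom_evalAt (φ : StrongDual ℝ E) : IsLatticeHom (evalAt φ) :=
  fun _ _ => ⟨rfl, rfl⟩

theorem eq_zero_of_freeNorm_eq_zero {f : evalLattice E} (hf : freeNorm E f = 0) : f = 0 := by
  refine Subtype.ext (funext fun φ => norm_le_zero_iff.1 ?_)
  -- The `+ 1` keeps the constant positive when `φ = 0`.
  have h := norm_map_le_mul_freeNorm (isLatticeHom_evalAt φ) (c := ‖φ‖₊ + 1) (by positivity)
    (fun x => (φ.le_opNorm x).trans (by
      push_cast
      gcongr
      exact le_add_of_nonneg_right zero_le_one)) f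
  rwa [hf, mul_zero] at h

theorem freeNorm_hat (x : E) : freeNorm E (hat E x) = ‖x‖ := by
  refine le_antisymm ((isGreatest_freeNorm E).1.2 x) ?_
  obtain ⟨φ, hφ, hφx⟩ := exists_dual_vector'' ℝ x
  have h := norm_map_le_mul_freeNorm (isLatticeHom_evalAt φ) (c := 1) one_pos
    (fun y => (φ.le_opNorm y).trans (mul_le_mul_of_nonneg_right hφ (norm_nonneg y))) (hat E x)
  rw [NNReal.coe_one, one_mul] at h
  refine le_trans ?_ h
  change ‖x‖ ≤ ‖φ x‖
  simp [hφx]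

theorem norm_map_le_norm_mul_freeNorm {Y : Type*} [NormedAddCommGroup Y] [NormedSpace ℝ Y]
    [Lattice Y] [HasSolidNorm Y] [IsOrderedAddMonoid Y] {S : evalLattice E →ₗ[ℝ] Y}
    (hS : IsLatticeHom S) {T : E →L[ℝ] Y} (h : ∀ x, S (hat E x) = T x) (f : evalLattice E) :
    ‖S f‖ ≤ ‖T‖ * freeNorm E f := by
  -- `‖T‖` may vanish, so the scaling uses `‖T‖ + ε` and lets `ε` tend to `0`.
  have hlim : Filter.Tendsto (fun ε : ℝ => (‖T‖ + ε) * freeNorm E f) (nhdsWithin 0 (Set.Ioi 0))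
      (nhds (‖T‖ * freeNorm E f)) := by
    have hc : Continuous fun ε : ℝ => (‖T‖ + ε) * freeNorm E f := by fun_prop
    simpa using (hc.tendsto 0).mono_left nhdsWithin_le_nhds
  refine ge_of_tendsto hlim (eventually_mem_nhdsWithin.mono fun ε (hε : 0 < ε) => ?_)
  refine norm_map_le_mul_freeNorm hS (c := ‖T‖₊ + ⟨ε, hε.le⟩)
    (add_pos_of_nonneg_of_pos zero_le hε) (fun x => ?_) f
  rw [h]
  exact (T.le_opNorm x).trans
    (mul_le_mul_of_nonneg_right (le_add_of_nonneg_right hε.le) (norm_nonneg x))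

theorem isLatticeHom_of_denseRange {V X Y : Type*} [AddCommGroup V] [Module ℝ V] [Lattice V]
    [NormedAddCommGroup X] [NormedSpace ℝ X] [Lattice X] [HasSolidNorm X] [IsOrderedAddMonoid X]
    [NormedAddCommGroup Y] [NormedSpace ℝ Y] [Lattice Y] [HasSolidNorm Y] [IsOrderedAddMonoid Y]
    {ι : V →ₗ[ℝ] X} (hι : IsLatticeHom ι) (hd : DenseRange ι) {S : X →L[ℝ] Y}
    (hS : IsLatticeHom ((S : X →ₗ[ℝ] Y) ∘ₗ ι)) : IsLatticeHom (S : X →ₗ[ℝ] Y) := by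
  have hsup : ∀ x y, S (x ⊔ y) = S x ⊔ S y := fun x y =>
    hd.induction_on₂ (isClosed_eq (S.continuous.comp (continuous_fst.sup continuous_snd))
      ((S.continuous.comp continuous_fst).sup (S.continuous.comp continuous_snd)))
      (fun f g => by
        rw [← (hι f g).1]
        exact (hS f g).1) x y
  have hinf : ∀ x y, S (x ⊓ y) = S x ⊓ S y := fun x y =>
    hd.induction_on₂ (isClosed_eq (S.continuous.comp (continuous_fst.inf continuous_snd))
      ((S.continuous.comp continuous_fst).inf (S.continuous.comp continuous_snd)))
      (fun f g => by
        rw [← (hι f g).2]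
        exact (hS f g).2) x y
  exact fun x y => ⟨hsup x y, hinf x y⟩

theorem IsLatticeHom.comp {V X Y : Type*} [AddCommGroup V] [Module ℝ V] [Lattice V]
    [AddCommGroup X] [Module ℝ X] [Lattice X] [AddCommGroup Y] [Module ℝ Y] [Lattice Y]
    {S : X →ₗ[ℝ] Y} {ι : V →ₗ[ℝ] X} (hS : IsLatticeHom S) (hι : IsLatticeHom ι) :
    IsLatticeHom (S ∘ₗ ι) := fun f g => by
  simp only [LinearMap.comp_apply, (hι f g).1, (hι f g).2, (hS _ _).1, (hS _ _).2, and_self]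

theorem isFreeBanachLattice_of_isLatticeCompletion {E : Type u} [NormedAddCommGroup E]
    [NormedSpace ℝ E] [CompleteSpace E] {X : Type v} [NormedAddCommGroup X] [NormedSpace ℝ X]
    [Lattice X] {ι : evalLattice E →ₗ[ℝ] X} (hι : IsLatticeCompletion (freeNorm E) X ι) :
    IsFreeBanachLattice.{u, v, w} E X (ι ∘ₗ hat E) := by
  have := hι.isBanachLattice
  have hnorm : ∀ x, ‖(ι ∘ₗ hat E) x‖ = ‖x‖ := fun x =>
    (hι.norm_map (hat E x)).trans (freeNorm_hat x)
  refine ⟨hι.isBanachLattice, hnorm, ?_, ?_⟩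
  · exact (LinearIsometry.isometry ⟨ι ∘ₗ hat E, hnorm⟩).isClosedEmbedding.isClosed_range
  intro Y _ _ _ _ T
  obtain ⟨S₀, hS₀, hS₀T⟩ := exists_latticeHom_extension (T : E →ₗ[ℝ] Y)
  have hbound : ∀ f, ‖S₀ f‖ ≤ ‖T‖ * ‖ι f‖ := fun f => by
    rw [hι.norm_map]
    exact norm_map_le_norm_mul_freeNorm hS₀ hS₀T f
  set S : X →L[ℝ] Y := S₀.extendOfNorm ι
  have hSι : ∀ f, S (ι f) = S₀ f := LinearMap.extendOfNorm_eq hι.denseRange ⟨_, hbound⟩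
  have hcomp : (S : X →ₗ[ℝ] Y) ∘ₗ ι = S₀ := LinearMap.ext hSι
  have hST : ∀ x, S (ι (hat E x)) = T x := fun x => (hSι _).trans (hS₀T x)
  refine ⟨S, isLatticeHom_of_denseRange hι.isLatticeHom hι.denseRange (hcomp ▸ hS₀), hST,
    le_antisymm (LinearMap.opNorm_extendOfNorm_le hι.denseRange (norm_nonneg T) hbound) ?_, ?_⟩
  · refine T.opNorm_le_bound (norm_nonneg S) fun x => ?_
    rw [← hST, ← hnorm x]
    exact S.le_opNorm _
  · intro R hR hRT
    -- `R` is not assumed bounded; positivity makes it continuous, so agreement on the dense range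
    -- of `ι` suffices.
    obtain ⟨C, hC⟩ := exists_bound_of_monotone hR.monotone
    have heq : R ∘ₗ ι = S₀ := latticeHom_ext (hR.comp hι.isLatticeHom) hS₀ fun x =>
      (hRT x).trans (hS₀T x).symm
    have hfun : (R : X → Y) = S := hι.denseRange.equalizer
      (R.mkContinuous C hC).continuous S.continuous
      (funext fun f => (LinearMap.congr_fun heq f).trans (hSι f).symm)
    exact DFunLike.coe_injective hfun

end FreeNorm

end FreeBanachLattice

theorem mainTheorem2 (E : Type u) [NormedAddCommGroup E] [NormedSpace ℝ E]
    [CompleteSpace E] :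
    ∃ ν : Seminorm ℝ (FreeBanachLattice.evalLattice E),
      -- `ν` is the largest lattice seminorm on `L` with `ν(x̂) ≤ ‖x‖`
      IsGreatest {p : Seminorm ℝ (FreeBanachLattice.evalLattice E) |
        FreeBanachLattice.IsLatticeSeminorm p ∧
          ∀ x : E, p (FreeBanachLattice.hat E x) ≤ ‖x‖} ν ∧
      -- it is a norm
      (∀ f : FreeBanachLattice.evalLattice E, ν f = 0 → f = 0) ∧
      -- it extends the norm of `E`
      (∀ x : E, ν (FreeBanachLattice.hat E x) = ‖x‖) ∧
      -- `L` has a completion with respect to `ν`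
      (∃ (X : Type u) (_ : NormedAddCommGroup X) (_ : NormedSpace ℝ X) (_ : Lattice X)
        (ι : FreeBanachLattice.evalLattice E →ₗ[ℝ] X),
        FreeBanachLattice.IsLatticeCompletion ν X ι) ∧
      -- and every such completion is the free Banach lattice `FBL[E]`
      (∀ (X : Type v) [NormedAddCommGroup X] [NormedSpace ℝ X] [Lattice X]
        (ι : FreeBanachLattice.evalLattice E →ₗ[ℝ] X),
        FreeBanachLattice.IsLatticeCompletion ν X ι →
          FreeBanachLattice.IsFreeBanachLattice.{u, v, w} E X
            (ι ∘ₗ FreeBanachLattice.hat E)) := by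
  exact ⟨FreeBanachLattice.freeNorm E, FreeBanachLattice.isGreatest_freeNorm E,
    fun _ => FreeBanachLattice.eq_zero_of_freeNorm_eq_zero, FreeBanachLattice.freeNorm_hat,
    FreeBanachLattice.exists_isLatticeCompletion (FreeBanachLattice.isGreatest_freeNorm E).1.1
      fun _ => FreeBanachLattice.eq_zero_of_freeNorm_eq_zero,
    fun _ _ _ _ _ => FreeBanachLattice.isFreeBanachLattice_of_isLatticeCompletion⟩
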